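/- There are absolute constants $K_1, K_2, K > 0$ with the following property. Let $A \subset \mathbb{C}$ be a finite set with $|A| = N$, and let $C$ be a real number with $K_1 \le C$ and $K_2\, C \le \sqrt{N}$. For $t \in \mathbb{C}$ write $A + tA = \{a + t a' : a, a' \in A\}$, and define $$T_C = \left\{ t \in \mathbb{C} \;:\; |A + tA| \le \frac{N^{1.5}}{C\sqrt{\log N}} \right\}.$$ Then $T_C$ is finite and $|T_C| \le K\, \dfrac{N}{C^2}$. -/

import Mathlib

open scoped Pointwise

/-- The set `T_C` of all complex `t` with `|A + tA| ≤ N ^ 1.5 / (C * √(log N))`, where `N = |A|`,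
`A + tA` is the sumset of `A` and its dilate `tA = {t a | a ∈ A}`. -/
noncomputable def dilateSet (A : Finset ℂ) (C : ℝ) : Set ℂ :=
  {t : ℂ | ((A + t • A).card : ℝ) ≤
    (A.card : ℝ) ^ (3 / 2 : ℝ) / (C * Real.sqrt (Real.log (A.card : ℝ)))}

/-! For fixed `t ≠ 0`, the `|A + tA|` lines `x + t y = s` cover `A × A`. Join each point of a line
to its nearest neighbour there. Discs reaching to nearest neighbours overlap at most nine-fold, so
all but `18 N / m` points of the line have a neighbour of rank at most `m` in both coordinates
(`card_not_hasCloseNeighbour_le`). If `|A + tA| ≤ L` and `m` is a suitable multiple of `L / N`, half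
of `A × A` has such neighbours. A point and its neighbour determine `t`, so each point serves at
most `m ^ 2` values of `t`; double counting gives `|S| ≤ 2 m ^ 2` (`card_dilates_le`). -/

/-- Two complex numbers in the same closed octant are closer to each other than the larger of
their moduli. -/
lemma normSq_sub_lt_of_octant {a b c d : ℝ} (ha : 0 ≤ a) (hb : 0 ≤ b) (hc : 0 ≤ c) (hd : 0 ≤ d)
    (hu : 0 < a ^ 2 + b ^ 2) (hv : 0 < c ^ 2 + d ^ 2)
    (h : (a ≤ b ∧ c ≤ d) ∨ (b ≤ a ∧ d ≤ c)) :
    (a - c) ^ 2 + (b - d) ^ 2 < a ^ 2 + b ^ 2 ∨ (a - c) ^ 2 + (b - d) ^ 2 < c ^ 2 + d ^ 2 := by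
  wlog hab : b ≤ a ∧ d ≤ c generalizing a b c d
  · have h' : a ≤ b ∧ c ≤ d := h.resolve_right hab
    have := this hb ha hd hc (by linarith) (by linarith) (Or.inr h') h'
    rcases this with this | this
    · left; linarith
    · right; linarith
  obtain ⟨hba, hdc⟩ := hab
  have ha' : 0 < a := by
    rcases ha.lt_or_eq with h | h
    · exact h
    · have : b = 0 := by linarith
      rw [this, ← h] at hu; norm_num at hu
  have hc' : 0 < c := by
    rcases hc.lt_or_eq with h | h
    · exact h
    · have : d = 0 := by linarith
      rw [this, ← h] at hv; norm_num at hv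
  by_contra! hcon
  obtain ⟨h1, h2⟩ := hcon
  have hbd := mul_nonneg hb hd
  -- `h1` gives `c² + d² ≥ 2ac + 2bd`, while `d ≤ c ≤ a` gives `c² + d² ≤ 2ac`. Equality forces `a =
  -- c = d` and `b = 0`, against `h2`; the other case is symmetric.
  rcases le_total c a with hca | hac
  · have e1 : 0 ≤ c * (a - c) := mul_nonneg hc (by linarith)
    have e2 : 0 ≤ (c - d) * (c + d) := mul_nonneg (by linarith) (by linarith)
    have e3 : c * (a - c) = 0 := by nlinarith
    have e4 : a = c := by
      rcases mul_eq_zero.1 e3 with h | h <;> linarith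
    subst e4
    have e5 : d * d = a * a := by nlinarith
    have e6 : b * b ≤ a * a := mul_le_mul hba hba hb ha
    nlinarith [mul_pos ha' ha']
  · have e1 : 0 ≤ a * (c - a) := mul_nonneg ha (by linarith)
    have e2 : 0 ≤ (a - b) * (a + b) := mul_nonneg (by linarith) (by linarith)
    have e3 : a * (c - a) = 0 := by nlinarith
    have e4 : c = a := by
      rcases mul_eq_zero.1 e3 with h | h <;> linarith
    subst e4
    have e5 : b * b = c * c := by nlinarith
    have e6 : d * d ≤ c * c := mul_le_mul hdc hdc hd hc
    nlinarith [mul_pos ha' ha']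

open Classical in
/-- The octant of a nonzero complex number, and `none` for zero. -/
noncomputable def octant (w : ℂ) : Option (Bool × Bool × Bool) :=
  if w = 0 then none else some (decide (0 ≤ w.re), decide (0 ≤ w.im), decide (|w.re| ≤ |w.im|))

/-- Equal signs allow folding both points into the first quadrant without changing their distance.
-/
lemma dist_lt_of_octant_eq {u v : ℂ} (hu : u ≠ 0) (h : octant u = octant v) :
    dist u v < ‖u‖ ∨ dist u v < ‖v‖ := by
  have hv : v ≠ 0 := by
    rintro rfl
    simp [octant, hu] at h
  simp only [octant, hu, hv, if_false, Option.some.injEq, Prod.mk.injEq, decide_eq_decide] at h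
  obtain ⟨h1, h2, h3⟩ := h
  have key : ∀ {p q : ℝ}, (0 ≤ p ↔ 0 ≤ q) → (|p| - |q|) ^ 2 = (p - q) ^ 2 := by
    intro p q hpq
    by_cases hp : 0 ≤ p
    · rw [abs_of_nonneg hp, abs_of_nonneg (hpq.1 hp)]
    · have hq : ¬ 0 ≤ q := fun hq => hp (hpq.2 hq)
      rw [abs_of_neg (not_le.1 hp), abs_of_neg (not_le.1 hq)]; ring
  have hpos : ∀ {w : ℂ}, w ≠ 0 → 0 < |w.re| ^ 2 + |w.im| ^ 2 := by
    intro w hw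
    have := Complex.normSq_pos.2 hw
    rw [Complex.normSq_apply] at this
    rw [sq_abs, sq_abs]; linarith
  have hnorm : ∀ w : ℂ, ‖w‖ ^ 2 = |w.re| ^ 2 + |w.im| ^ 2 := by
    intro w
    rw [← Complex.normSq_eq_norm_sq, Complex.normSq_apply, sq_abs, sq_abs]; ring
  have hd : dist u v ^ 2 = (|u.re| - |v.re|) ^ 2 + (|u.im| - |v.im|) ^ 2 := by
    rw [dist_eq_norm, hnorm, key h1, key h2, sq_abs, sq_abs, Complex.sub_re, Complex.sub_im]
  have hor : (|u.re| ≤ |u.im| ∧ |v.re| ≤ |v.im|) ∨ (|u.im| ≤ |u.re| ∧ |v.im| ≤ |v.re|) := by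
    by_cases h : |u.re| ≤ |u.im|
    · exact Or.inl ⟨h, h3.1 h⟩
    · exact Or.inr ⟨(not_le.1 h).le, (not_le.1 fun h' => h (h3.2 h')).le⟩
  have := normSq_sub_lt_of_octant (abs_nonneg _) (abs_nonneg _) (abs_nonneg _) (abs_nonneg _)
    (hpos hu) (hpos hv) hor
  rw [← hd, ← hnorm, ← hnorm] at this
  exact this.imp (lt_of_pow_lt_pow_left₀ 2 (norm_nonneg _))
    (lt_of_pow_lt_pow_left₀ 2 (norm_nonneg _))

/-- A point of the plane lies in at most nine discs `D(xᵢ, rᵢ)` none of which contains the centre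
of another one in its interior. -/
lemma card_filter_dist_le_nine {ι : Type*} (X : Finset ι) (f : ι → ℂ) (r : ι → ℝ)
    (hf : Set.InjOn f X) (hr : ∀ i ∈ X, ∀ j ∈ X, i ≠ j → r i ≤ dist (f i) (f j)) (z : ℂ) :
    (X.filter fun i => dist (f i) z ≤ r i).card ≤ 9 := by
  have hcard : (Finset.univ : Finset (Option (Bool × Bool × Bool))).card = 9 := by decide
  rw [← hcard]
  refine Finset.card_le_card_of_injOn (fun i => octant (f i - z)) (fun _ _ => Finset.mem_univ _) ?_
  intro i hi j hj hij
  simp only [Finset.coe_filter, Set.mem_ofPred_eq] at hi hj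
  by_contra hne
  by_cases hzero : f i - z = 0
  · have hj0 : f j - z = 0 := by
      by_contra h0
      simp [octant, hzero, h0] at hij
    exact hne (hf hi.1 hj.1 (by rw [sub_eq_zero.1 hzero, sub_eq_zero.1 hj0]))
  · have hi' := hr i hi.1 j hj.1 hne
    have hj' := hr j hj.1 i hi.1 (Ne.symm hne)
    rw [dist_comm] at hj'
    have := dist_lt_of_octant_eq hzero hij
    rw [dist_sub_right, ← dist_eq_norm, ← dist_eq_norm] at this
    rcases this with h | h
    · linarith [hi.2]
    · linarith [hj.2]

/-- Among discs none of which contains the centre of another one in its interior, few contain many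
points of `A`. -/
lemma card_rich_discs_mul_le {ι : Type*} (A : Finset ℂ) (X : Finset ι) (f : ι → ℂ) (r : ι → ℝ)
    (hf : Set.InjOn f X) (hr : ∀ i ∈ X, ∀ j ∈ X, i ≠ j → r i ≤ dist (f i) (f j)) (m : ℝ) :
    ((X.filter fun i => m < ((A.filter fun z => dist (f i) z ≤ r i).card : ℝ)).card : ℝ) * m
      ≤ 9 * A.card := by
  have h1 : ∑ i ∈ X, (A.filter fun z => dist (f i) z ≤ r i).card ≤ 9 * A.card := by
    have := Finset.sum_card_bipartiteAbove_eq_sum_card_bipartiteBelow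
      (s := X) (t := A) (fun i z => dist (f i) z ≤ r i)
    simp only [Finset.bipartiteAbove, Finset.bipartiteBelow] at this
    rw [this, mul_comm]
    exact Finset.sum_le_card_nsmul _ _ _ fun z _ => card_filter_dist_le_nine X f r hf hr z
  calc _ = ∑ i ∈ X.filter fun i => m < ((A.filter fun z => dist (f i) z ≤ r i).card : ℝ), m := by
        rw [Finset.sum_const, nsmul_eq_mul]
    _ ≤ ∑ i ∈ X.filter fun i => m < ((A.filter fun z => dist (f i) z ≤ r i).card : ℝ),
          ((A.filter fun z => dist (f i) z ≤ r i).card : ℝ) :=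
        Finset.sum_le_sum fun i hi => (Finset.mem_filter.1 hi).2.le
    _ ≤ ∑ i ∈ X, ((A.filter fun z => dist (f i) z ≤ r i).card : ℝ) :=
        Finset.sum_le_sum_of_subset_of_nonneg (Finset.filter_subset _ _)
          fun _ _ _ => Nat.cast_nonneg _
    _ ≤ 9 * A.card := by exact_mod_cast h1

open Classical in
/-- The points `a'` of `A` such that at most `m` points of `A` are no further from `a`
than `a'` is. -/
noncomputable def closePoints (A : Finset ℂ) (m : ℝ) (a : ℂ) : Finset ℂ :=
  A.filter fun a' => ((A.filter fun z => dist a z ≤ dist a a').card : ℝ) ≤ m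

/-- The disc reaching to the furthest close point contains all the others. -/
lemma card_closePoints_le (A : Finset ℂ) {m : ℝ} (hm : 0 ≤ m) (a : ℂ) :
    ((closePoints A m a).card : ℝ) ≤ m := by
  rcases (closePoints A m a).eq_empty_or_nonempty with h | h
  · simpa [h] using hm
  · obtain ⟨x, hx, hmax⟩ := Finset.exists_max_image _ (fun y => dist a y) h
    refine le_trans ?_ (Finset.mem_filter.1 hx).2
    exact_mod_cast Finset.card_le_card fun y hy =>
      Finset.mem_filter.2 ⟨(Finset.mem_filter.1 hy).1, hmax y hy⟩

/-- `p` has a neighbour on the line `x + t y = const` through `p` which is close to `p` in both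
coordinates. -/
def HasCloseNeighbour (A : Finset ℂ) (m : ℝ) (t : ℂ) (p : ℂ × ℂ) : Prop :=
  ∃ q : ℂ × ℂ, q.1 ∈ closePoints A m p.1 ∧ q.2 ∈ closePoints A m p.2 ∧ q.2 ≠ p.2 ∧
    p.1 + t * p.2 = q.1 + t * q.2

open Classical in
/-- On a line few points of `A × A` are without a close neighbour. -/
lemma card_not_hasCloseNeighbour_le (A : Finset ℂ) {m : ℝ} (hm : 0 < m) {t : ℂ} (ht : t ≠ 0)
    (s : ℂ) (F : Finset (ℂ × ℂ)) (hFA : F ⊆ A ×ˢ A) (hFs : ∀ p ∈ F, p.1 + t * p.2 = s) :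
    ((F.filter fun p => ¬ HasCloseNeighbour A m t p).card : ℝ) ≤ 18 * A.card / m + 1 := by
  -- A lone point has no neighbour on its line; this is the source of the `+ 1`.
  rcases le_or_gt F.card 1 with hF | hF
  · have : ((F.filter fun p => ¬ HasCloseNeighbour A m t p).card : ℝ) ≤ 1 := by
      exact_mod_cast (Finset.card_filter_le _ _).trans hF
    have : 0 ≤ 18 * A.card / m := by positivity
    linarith
  have hnn : ∀ p : ℂ × ℂ, ∃ q : ℂ × ℂ, p ∈ F → q ∈ F ∧ q ≠ p ∧
      ∀ q' ∈ F, p ≠ q' → dist p.2 q.2 ≤ dist p.2 q'.2 := by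
    intro p
    by_cases hp : p ∈ F
    · have hne : (F.erase p).Nonempty := by
        rw [← Finset.card_pos, Finset.card_erase_of_mem hp]; omega
      obtain ⟨q, hq, hmin⟩ := Finset.exists_min_image _ (fun y : ℂ × ℂ => dist p.2 y.2) hne
      exact ⟨q, fun _ => ⟨Finset.mem_of_mem_erase hq, Finset.ne_of_mem_erase hq,
        fun q' hq' hpq => hmin q' (Finset.mem_erase.2 ⟨Ne.symm hpq, hq'⟩)⟩⟩
    · exact ⟨p, fun h => absurd h hp⟩
  choose g hg using hnn
  have hfst : ∀ p ∈ F, p.1 = s - t * p.2 := fun p hp => eq_sub_of_add_eq (hFs p hp)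
  -- The two projections of the line are similar, with ratio `‖t‖`, so `g p` is nearest to `p` in
  -- both.
  have hdist : ∀ p ∈ F, ∀ q ∈ F, dist p.1 q.1 = ‖t‖ * dist p.2 q.2 := by
    intro p hp q hq
    rw [hfst p hp, hfst q hq, dist_sub_left, dist_eq_norm, dist_eq_norm, ← mul_sub, norm_mul]
  have inj2 : Set.InjOn (fun p : ℂ × ℂ => p.2) F := by
    intro p hp q hq h
    have h : p.2 = q.2 := h
    exact Prod.ext (by rw [hfst p hp, hfst q hq, h]) h
  have inj1 : Set.InjOn (fun p : ℂ × ℂ => p.1) F := by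
    intro p hp q hq h
    have h : p.1 = q.1 := h
    rw [hfst p hp, hfst q hq] at h
    exact inj2 hp hq (mul_left_cancel₀ ht (sub_right_injective h))
  have b1 := card_rich_discs_mul_le A F (fun p => p.1) (fun p => dist p.1 (g p).1) inj1
    (by
      intro p hp q hq hpq
      rw [hdist p hp _ (hg p hp).1, hdist p hp q hq]
      exact mul_le_mul_of_nonneg_left ((hg p hp).2.2 q hq hpq) (norm_nonneg _)) m
  have b2 := card_rich_discs_mul_le A F (fun p => p.2) (fun p => dist p.2 (g p).2) inj2
    (fun p hp q hq hpq => (hg p hp).2.2 q hq hpq) m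
  have hsub : (F.filter fun p => ¬ HasCloseNeighbour A m t p) ⊆
      (F.filter fun p => m < ((A.filter fun z => dist p.1 z ≤ dist p.1 (g p).1).card : ℝ)) ∪
      (F.filter fun p => m < ((A.filter fun z => dist p.2 z ≤ dist p.2 (g p).2).card : ℝ)) := by
    intro p hp
    obtain ⟨hpF, hp⟩ := Finset.mem_filter.1 hp
    rw [Finset.mem_union, Finset.mem_filter, Finset.mem_filter]
    by_contra! hcon
    obtain ⟨hgF, hgne, -⟩ := hg p hpF
    have hgA := Finset.mem_product.1 (hFA hgF)
    refine hp ⟨g p, Finset.mem_filter.2 ⟨hgA.1, hcon.1 hpF⟩,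
      Finset.mem_filter.2 ⟨hgA.2, hcon.2 hpF⟩, fun h => hgne (inj2 hgF hpF h), ?_⟩
    rw [hFs p hpF, hFs _ hgF]
  have hle := (Finset.card_le_card hsub).trans (Finset.card_union_le _ _)
  have hle' := (Nat.cast_le (α := ℝ)).2 hle
  rw [Nat.cast_add] at hle'
  have hmul := mul_le_mul_of_nonneg_right hle' hm.le
  have : ((F.filter fun p => ¬ HasCloseNeighbour A m t p).card : ℝ) ≤ 18 * A.card / m := by
    rw [le_div_iff₀ hm]
    linarith
  linarith

open Classical in
/-- If `A + tA` is small then most points of `A × A` have close neighbours. -/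
lemma card_sq_le_card_hasCloseNeighbour_add (A : Finset ℂ) {m : ℝ} (hm : 0 < m) {t : ℂ}
    (ht : t ≠ 0) :
    (A.card : ℝ) ^ 2 ≤ ((A ×ˢ A).filter fun p => HasCloseNeighbour A m t p).card +
      (A + t • A).card * (18 * A.card / m + 1) := by
  have h1 : ((A ×ˢ A).filter fun p => HasCloseNeighbour A m t p).card +
      ((A ×ˢ A).filter fun p => ¬ HasCloseNeighbour A m t p).card = A.card * A.card := by
    rw [Finset.card_filter_add_card_filter_not, Finset.card_product]
  have hmaps : ∀ p ∈ (A ×ˢ A).filter (fun p => ¬ HasCloseNeighbour A m t p),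
      p.1 + t * p.2 ∈ A + t • A := by
    intro p hp
    have hp := Finset.mem_product.1 (Finset.mem_filter.1 hp).1
    exact Finset.add_mem_add hp.1 (Finset.smul_mem_smul_finset hp.2)
  have h2 := Finset.card_eq_sum_card_fiberwise hmaps
  have h3 : (((A ×ˢ A).filter fun p => ¬ HasCloseNeighbour A m t p).card : ℝ) ≤
      (A + t • A).card * (18 * A.card / m + 1) := by
    rw [h2, Nat.cast_sum, ← nsmul_eq_mul]
    refine Finset.sum_le_card_nsmul _ _ _ fun s _ => ?_
    rw [Finset.filter_comm]
    refine card_not_hasCloseNeighbour_le A hm ht s _ (Finset.filter_subset _ _) fun p hp => ?_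
    exact (Finset.mem_filter.1 hp).2
  have h1' : (((A ×ˢ A).filter fun p => HasCloseNeighbour A m t p).card : ℝ) +
      ((A ×ˢ A).filter fun p => ¬ HasCloseNeighbour A m t p).card = (A.card : ℝ) * A.card := by
    exact_mod_cast h1
  rw [sq]
  linarith

-- Given `p`, the neighbour `q` determines `t` as a quotient of differences.
open Classical in
lemma card_filter_hasCloseNeighbour_le (A : Finset ℂ) {m : ℝ} (hm : 0 ≤ m) (S : Finset ℂ)
    (p : ℂ × ℂ) : ((S.filter fun t => HasCloseNeighbour A m t p).card : ℝ) ≤ m ^ 2 := by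
  have hsub : (S.filter fun t => HasCloseNeighbour A m t p) ⊆
      (closePoints A m p.1 ×ˢ closePoints A m p.2).image
        fun q => (p.1 - q.1) / (q.2 - p.2) := by
    intro t ht
    obtain ⟨q, h1, h2, hne, he⟩ := (Finset.mem_filter.1 ht).2
    refine Finset.mem_image.2 ⟨q, Finset.mem_product.2 ⟨h1, h2⟩, ?_⟩
    rw [div_eq_iff (sub_ne_zero.2 hne)]
    linear_combination he
  have h := (Finset.card_le_card hsub).trans Finset.card_image_le
  rw [Finset.card_product] at h
  calc _ ≤ ((closePoints A m p.1).card : ℝ) * (closePoints A m p.2).card := by exact_mod_cast h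
    _ ≤ m * m := mul_le_mul (card_closePoints_le A hm _) (card_closePoints_le A hm _)
        (Nat.cast_nonneg _) hm
    _ = m ^ 2 := (sq m).symm

/-- A Szemerédi–Trotter type bound on the number of nonzero `t` with `|A + tA| ≤ L`. -/
lemma card_dilates_le (A : Finset ℂ) (hA : A.Nonempty) {L : ℝ} (hL : 0 < L)
    (hL' : L ≤ (A.card : ℝ) ^ 2 / 4) (S : Finset ℂ)
    (hS : ∀ t ∈ S, t ≠ 0 ∧ ((A + t • A).card : ℝ) ≤ L) :
    (S.card : ℝ) ≤ 10368 * (L / A.card) ^ 2 := by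
  classical
  have hN : (0 : ℝ) < A.card := by exact_mod_cast hA.card_pos
  set N : ℝ := (A.card : ℝ) with hNdef
  -- With 72, the exceptional points number at most `N² / 4 + L ≤ N² / 2`.
  set m : ℝ := 72 * L / N with hmdef
  have hm : 0 < m := by positivity
  have hrich : ∀ t ∈ S, N ^ 2 / 2 ≤
      (((A ×ˢ A).filter fun p => HasCloseNeighbour A m t p).card : ℝ) := by
    intro t ht
    obtain ⟨ht0, htL⟩ := hS t ht
    have h := card_sq_le_card_hasCloseNeighbour_add A hm ht0
    have h2 : ((A + t • A).card : ℝ) * (18 * A.card / m + 1) ≤ L * (18 * N / m + 1) :=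
      mul_le_mul_of_nonneg_right htL (by positivity)
    have h3 : L * (18 * N / m + 1) = N ^ 2 / 4 + L := by
      rw [hmdef]; field_simp; ring
    linarith
  have hswap := Finset.sum_card_bipartiteAbove_eq_sum_card_bipartiteBelow
    (s := S) (t := A ×ˢ A) (fun t p => HasCloseNeighbour A m t p)
  simp only [Finset.bipartiteAbove, Finset.bipartiteBelow] at hswap
  have hlow := Finset.card_nsmul_le_sum S _ _ hrich
  have hup := Finset.sum_le_card_nsmul (A ×ˢ A) _ _
    fun p _ => card_filter_hasCloseNeighbour_le A hm.le S p
  rw [← Nat.cast_sum, nsmul_eq_mul] at hlow hup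
  rw [hswap] at hlow
  rw [Finset.card_product, Nat.cast_mul, ← hNdef] at hup
  have hmain : (S.card : ℝ) * (N ^ 2 / 2) ≤ (2 * m ^ 2) * (N ^ 2 / 2) := by linarith
  have := le_of_mul_le_mul_right hmain (by positivity)
  calc (S.card : ℝ) ≤ 2 * m ^ 2 := this
    _ = 10368 * (L / N) ^ 2 := by rw [hmdef]; ring

theorem theorem3 :
    ∃ K₁ K₂ K : ℝ, 0 < K₁ ∧ 0 < K₂ ∧ 0 < K ∧
      ∀ (N : ℕ) (A : Finset ℂ) (C : ℝ), A.card = N →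
        K₁ ≤ C → K₂ * C ≤ Real.sqrt (N : ℝ) →
          (dilateSet A C).Finite ∧ ((dilateSet A C).ncard : ℝ) ≤ K * ((N : ℝ) / C ^ 2) := by
  -- `C ≥ 4` yields `L ≤ N² / 4` and `N ≥ 16 > e`, so the logarithm only helps. The constant is `2 ·
  -- 72² + 1`, where the 1 pays for `t = 0` because `N / C² ≥ 1`.
  refine ⟨4, 1, 10369, by norm_num, by norm_num, by norm_num, ?_⟩
  rintro N A C rfl hC hCN
  rw [one_mul] at hCN
  have hC0 : 0 < C := by linarith
  have hN : C ^ 2 ≤ (A.card : ℝ) := (Real.le_sqrt hC0.le (Nat.cast_nonneg _)).1 hCN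
  have hN16 : (16 : ℝ) ≤ A.card := by nlinarith
  have hA : A.Nonempty := Finset.card_pos.1 (by exact_mod_cast (by linarith : (0 : ℝ) < A.card))
  set x : ℝ := (A.card : ℝ) with hx
  have hx0 : 0 < x := by linarith
  have hlog : 1 ≤ Real.log x := by
    rw [Real.le_log_iff_exp_le hx0]
    linarith [Real.exp_one_lt_d9]
  have hsl : 1 ≤ Real.sqrt (Real.log x) := Real.one_le_sqrt.2 hlog
  set L : ℝ := x ^ (3 / 2 : ℝ) / (C * Real.sqrt (Real.log x)) with hLdef
  have hpow : x ^ (3 / 2 : ℝ) = x * Real.sqrt x := by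
    rw [Real.sqrt_eq_rpow, ← Real.rpow_one_add' hx0.le (by norm_num)]; norm_num
  have hL : 0 < L := by positivity
  have hLC : L ≤ x * Real.sqrt x / C := by
    rw [hLdef, hpow]
    exact div_le_div_of_nonneg_left (by positivity) hC0 (le_mul_of_one_le_right hC0.le hsl)
  have hsx : Real.sqrt x ≤ x := by
    rw [Real.sqrt_le_left hx0.le]; nlinarith
  have hL4 : L ≤ x ^ 2 / 4 := by
    refine hLC.trans ?_
    rw [sq]
    exact div_le_div₀ (by positivity) (mul_le_mul_of_nonneg_left hsx hx0.le) (by norm_num) hC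
  have hLx : (L / x) ^ 2 ≤ x / C ^ 2 := by
    have h : L / x ≤ Real.sqrt x / C := by
      rw [div_le_iff₀ hx0]
      exact hLC.trans_eq (by ring)
    calc (L / x) ^ 2 ≤ (Real.sqrt x / C) ^ 2 := pow_le_pow_left₀ (by positivity) h 2
      _ = x / C ^ 2 := by rw [div_pow, Real.sq_sqrt hx0.le]
  have hone : 1 ≤ x / C ^ 2 := (one_le_div (by positivity)).2 hN
  have hbound : ∀ S : Finset ℂ, (S : Set ℂ) ⊆ dilateSet A C →
      (S.card : ℝ) ≤ 10369 * (x / C ^ 2) := by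
    intro S hS
    have h := card_dilates_le A hA hL hL4 (S.erase 0) fun t ht =>
      ⟨Finset.ne_of_mem_erase ht, hS (Finset.mem_of_mem_erase ht)⟩
    have h' : (S.card : ℝ) ≤ (S.erase 0).card + 1 := by
      have := Finset.pred_card_le_card_erase (s := S) (a := (0 : ℂ))
      exact_mod_cast (by omega : S.card ≤ (S.erase 0).card + 1)
    linarith
  have hfin : (dilateSet A C).Finite := by
    by_contra hinf
    obtain ⟨S, hS, hcard⟩ := Set.Infinite.exists_subset_card_eq hinf
      (⌊10369 * (x / C ^ 2)⌋₊ + 1)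
    have h1 := hbound S hS
    rw [hcard] at h1
    push_cast at h1
    linarith [Nat.lt_floor_add_one (10369 * (x / C ^ 2))]
  refine ⟨hfin, ?_⟩
  rw [Set.ncard_eq_toFinset_card _ hfin]
  exact hbound _ (by simp)
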